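/- **Setting.** Let $p_0,p_1,p_2,\dots$ be distribution functions of non-negative real random variables. For each $n$ let $V$ be an $n$-point set and let $(u_\sigma)$, $\emptyset\ne\sigma\subset V$, be independent non-negative random variables such that $u_\sigma$ has distribution function $p_{\#\sigma-1}$. Let $\mathcal X_n=\{X_n(t)\}_{t\ge 0}$ be the random filtration of simplicial complexes $$X_n(t)=\{\emptyset\ne\sigma\subset V : u_\tau\le t\ \text{for every}\ \emptyset\ne\tau\subset\sigma\}.$$ For $k\ge 0$, let $H_k(X_n(t))$ be the $k$-th reduced simplicial homology with real coefficients. The persistent homology $\bigoplus_{t\ge0}H_k(X_n(t))$, as a graded module over $\mathbb R[\mathbb R_{\ge0}]$ (where $z^{t-s}$ acts as the map $H_k(X_n(s))\to H_k(X_n(t))$ induced by inclusion), decomposes into finitely many interval modules $(z^{b_i})/(z^{d_i})$ with $0\le b_i<d_i\le\infty$ (read as $(z^{b_i})$ if $d_i=\infty$), and these intervals are unique up to order. Put $$L_k(\mathcal X_n)=\sum_i (d_i-b_i),\qquad (L_k(\mathcal X_n))_T=\sum_i\bigl((d_i\wedge T)-(b_i\wedge T)\bigr)\quad(T\ge 0).$$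 Further let $q_{-1}=1$, $q_k(t)=\prod_{i=0}^{k}p_i(t)^{\binom{k+1}{i+1}}$ for $k\ge 0$, and $r_k(t)=q_{k+1}(t)/q_k(t)$ for $k\ge -1$ (with $0/0=0$). For $u\in[0,1)$ set $$\check r_k(u)=\inf\{t\ge0 : r_k(t)>u\},\qquad Q_k(t)=\int_0^t q_k(s)\,ds,$$ $$\Phi_k(u)=Q_k(\check r_k(u)),\qquad \Psi_k(u)=Q_k(\check r_{k-1}(u)).$$ **Theorem.** Let $k\ge0$. Suppose that there exist $u_0\in(0,1)$, $B>1$ and $D\in\bigl[0,\tfrac{k+2}{4(k+1)}\bigr)$ such that $$\Phi_k(Du)\ge B\,\Psi_k(u)\quad\text{for } 0\le u\le u_0 .$$ Then there exists $c>0$ such that for every $T>\check r_k(0)$, $$\mathbb E\bigl[(L_k(\mathcal X_n))_T\bigr]\ge c\,n^{k+1}\Phi_k(1/n)\quad\text{for all sufficiently large } n$$ (how large may depend on $T$). In particular $\mathbb E[L_k(\mathcal X_n)]=\Omega(n^{k+1}\Phi_k(1/n))$; that is, there is $c'>0$ with $\mathbb E[L_k(\mathcal X_n)]\ge c'\,n^{k+1}\Phi_k(1/n)$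 for all sufficiently large $n$, where the expectation may be $+\infty$. -/

import Mathlib

open MeasureTheory ProbabilityTheory Filter
open scoped NNReal ENNReal

noncomputable section

namespace LifetimeSum

/-! ### Reduced simplicial homology over `ℝ` on the vertex set `Fin n`

A simplex is oriented by the order of its vertices, so that the chains of a complex are the real
linear combinations of its faces. All chain spaces are subspaces of the space
`Finset (Fin n) → ℝ` with basis `⟨σ⟩ = Pi.single σ 1`; the empty set is the `(-1)`-simplex,
spanning `C_{-1} = ℝ`. -/

/-- The boundary map: for `σ = {v₀ < ⋯ < v_k}` it sends `⟨σ⟩` to `∑ i, (-1) ^ i ⟨σ \ {v_i}⟩`.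
In particular `⟨v⟩ ↦ ⟨∅⟩`, which is the augmentation `∂₀ ⟨v⟩ = 1`. -/
def boundary (n : ℕ) : (Finset (Fin n) → ℝ) →ₗ[ℝ] (Finset (Fin n) → ℝ) :=
  Fintype.linearCombination ℝ fun σ : Finset (Fin n) =>
    ∑ v ∈ σ, Pi.single (σ.erase v) ((-1 : ℝ) ^ (σ.filter (· < v)).card)

variable {n : ℕ}

/-- `C_k(X)`: the combinations of the `k`-simplices (faces with `k + 1` vertices) of `X`. -/
def chains (X : PreAbstractSimplicialComplex (Fin n)) (k : ℕ) :
    Submodule ℝ (Finset (Fin n) → ℝ) where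
  carrier := {f | ∀ σ, f σ ≠ 0 → σ ∈ X ∧ σ.card = k + 1}
  zero_mem' := fun _ h => absurd rfl h
  add_mem' := fun {f g} hf hg σ h => by
    by_cases h0 : f σ = 0
    · exact hg σ fun h1 => h (by simp [h0, h1])
    · exact hf σ h0
  smul_mem' := fun c f hf σ h => hf σ fun h0 => h (by simp [h0])

/-- The `k`-cycles `ker ∂_k`. -/
def cycles (X : PreAbstractSimplicialComplex (Fin n)) (k : ℕ) :
    Submodule ℝ (Finset (Fin n) → ℝ) :=
  chains X k ⊓ LinearMap.ker (boundary n)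

/-- The `k`-boundaries `im ∂_{k+1}`. -/
def boundaries (X : PreAbstractSimplicialComplex (Fin n)) (k : ℕ) :
    Submodule ℝ (Finset (Fin n) → ℝ) :=
  (chains X (k + 1)).map (boundary n)

/-- The reduced homology `H_k(X) = ker ∂_k / im ∂_{k+1}`, for `k ≥ 0`. -/
abbrev Homology (X : PreAbstractSimplicialComplex (Fin n)) (k : ℕ) : Type :=
  cycles X k ⧸ (boundaries X k).submoduleOf (cycles X k)

theorem chains_mono {X Y : PreAbstractSimplicialComplex (Fin n)} (h : X ≤ Y) (k : ℕ) :
    chains X k ≤ chains Y k :=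
  fun _ hf σ hσ => ⟨h (hf σ hσ).1, (hf σ hσ).2⟩

theorem cycles_mono {X Y : PreAbstractSimplicialComplex (Fin n)} (h : X ≤ Y) (k : ℕ) :
    cycles X k ≤ cycles Y k :=
  inf_le_inf_right _ (chains_mono h k)

theorem boundaries_mono {X Y : PreAbstractSimplicialComplex (Fin n)} (h : X ≤ Y) (k : ℕ) :
    boundaries X k ≤ boundaries Y k :=
  Submodule.map_mono (chains_mono h (k + 1))

/-- The map `H_k(X) → H_k(Y)` induced by an inclusion `X ⊆ Y`. -/
def homologyMap {X Y : PreAbstractSimplicialComplex (Fin n)} (h : X ≤ Y) (k : ℕ) :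
    Homology X k →ₗ[ℝ] Homology Y k :=
  Submodule.mapQ _ _ (Submodule.inclusion (cycles_mono h k)) fun _ hx =>
    boundaries_mono h k hx

/-! ### Persistent homology and lifetime sums -/

/-- A decomposition of the `k`-th persistent homology of the filtration `X` into finitely many
intervals: births `b i < d i` deaths (`d i = ∞` allowed) and an isomorphism of graded modules
`⨁ t, H_k(X t) ≃ ⨁ i, (z ^ b i) / (z ^ d i)` (the summand is `(z ^ b i)` when `d i = ∞`).
The degree-`t` part of the right-hand side has one coordinate for every `i` with `b i ≤ t < d i`.
The isomorphism is given degree by degree, and commutation with the multiplication by `z ^ (t - s)`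
is the field `iso_map`: the `i`-th coordinate is kept from degree `s` to degree `t` if the `i`-th
interval contains both. -/
structure Barcode (X : ℝ≥0 →o PreAbstractSimplicialComplex (Fin n)) (k : ℕ) where
  /-- the number of intervals -/
  size : ℕ
  /-- the birth times -/
  birth : Fin size → ℝ≥0
  /-- the death times -/
  death : Fin size → ℝ≥0∞
  birth_lt_death : ∀ i, (birth i : ℝ≥0∞) < death i
  /-- the isomorphism in degree `t` -/
  iso : ∀ t : ℝ≥0,
    Homology (X t) k ≃ₗ[ℝ] ({i : Fin size // birth i ≤ t ∧ (t : ℝ≥0∞) < death i} → ℝ)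
  iso_map : ∀ (s t : ℝ≥0) (hst : s ≤ t) (x : Homology (X s) k)
    (i : {i : Fin size // birth i ≤ t ∧ (t : ℝ≥0∞) < death i}),
    iso t (homologyMap (X.monotone hst) k x) i =
      if hs : birth i ≤ s then
        iso s x ⟨i, hs, lt_of_le_of_lt (ENNReal.coe_le_coe.2 hst) i.2.2⟩
      else 0

/-- The lifetime sum `L_k(X) = ∑ i, (d i - b i)`. The intervals of a barcode are unique up to
reindexing, so the supremum is over a single value. -/
def lifetimeSum (X : ℝ≥0 →o PreAbstractSimplicialComplex (Fin n)) (k : ℕ) : ℝ≥0∞ :=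
  ⨆ β : Barcode X k, ∑ i, (β.death i - (β.birth i : ℝ≥0∞))

/-- The lifetime sum until time `T`, `(L_k(X))_T = ∑ i, (min (d i) T - min (b i) T)`. -/
def lifetimeSumUntil (X : ℝ≥0 →o PreAbstractSimplicialComplex (Fin n)) (k : ℕ) (T : ℝ≥0) :
    ℝ≥0∞ :=
  ⨆ β : Barcode X k, ∑ i, (min (β.death i) (T : ℝ≥0∞) - min (β.birth i : ℝ≥0∞) (T : ℝ≥0∞))

/-! ### The multi-parameter complex process -/

/-- Given times `u_σ` for all nonempty `σ`, the filtration whose complex at time `t` consists of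
the nonempty `σ` such that `u_τ ≤ t` for every nonempty `τ ⊆ σ`. -/
def complexProcess (u : {σ : Finset (Fin n) // σ.Nonempty} → ℝ) :
    ℝ≥0 →o PreAbstractSimplicialComplex (Fin n) where
  toFun t :=
    { faces := {σ | σ.Nonempty ∧ ∀ τ : {τ : Finset (Fin n) // τ.Nonempty}, τ.1 ⊆ σ → u τ ≤ t}
      isRelLowerSet_faces := fun _ hσ =>
        ⟨hσ.1, fun _ hτ hne => ⟨hne, fun ρ hρ => hσ.2 ρ (hρ.trans hτ)⟩⟩ }
  monotone' := fun _ _ hst _ hσ =>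
    ⟨hσ.1, fun τ hτ => (hσ.2 τ hτ).trans (NNReal.coe_le_coe.2 hst)⟩

/-! ### The functions attached to the multi-parameter `p`

The first index of `q` and `r` is shifted by one to be a natural number. -/

/-- `q p m` is `q_{m-1}`, the product over `i = 0, …, m - 1` of `p_i ^ (m choose (i + 1))`;
`q p 0 = q_{-1} = 1`. -/
def q (p : ℕ → ℝ → ℝ) (m : ℕ) (t : ℝ) : ℝ :=
  ∏ i ∈ Finset.range m, p i t ^ m.choose (i + 1)

/-- `r p m` is `r_{m-1} = q_m / q_{m-1}`, with `0 / 0 = 0`. -/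
def r (p : ℕ → ℝ → ℝ) (m : ℕ) (t : ℝ) : ℝ :=
  q p (m + 1) t / q p m t

/-- `rInv p m` is the generalized inverse of `r_{m-1}`, to be used at `x < 1`. -/
def rInv (p : ℕ → ℝ → ℝ) (m : ℕ) (x : ℝ) : ℝ :=
  sInf {t : ℝ | 0 ≤ t ∧ x < r p m t}

/-- `Q_k(t) = ∫₀ᵗ q_k(s) ds` (here `k` is not shifted). -/
def Q (p : ℕ → ℝ → ℝ) (k : ℕ) (t : ℝ) : ℝ :=
  ∫ s in (0 : ℝ)..t, q p (k + 1) s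

/-- `Φ_k(x) = Q_k` at the generalized inverse of `r_k` at `x`. -/
def Phi (p : ℕ → ℝ → ℝ) (k : ℕ) (x : ℝ) : ℝ :=
  Q p k (rInv p (k + 1) x)

/-- `Ψ_k(x) = Q_k` at the generalized inverse of `r_{k-1}` at `x`. -/
def Psi (p : ℕ → ℝ → ℝ) (k : ℕ) (x : ℝ) : ℝ :=
  Q p k (rInv p k x)

end LifetimeSum

end

/-! The Betti number β_k(X(t)) counts the bars alive at time t, so its integral over a window inside
[0, T] is at most (L_k)_T (`lintegral_finrank_homology_le_lifetimeSumUntil`). Lifetime sums are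
suprema over barcodes, so for a lower bound one barcode suffices; `nonempty_barcode` builds it from
a basis adapted to the cycles and to the boundaries of all X(t) at once.

The Morse inequality β_k ≥ f_k - f_{k+1} - f_{k-1} (`ncard_faceSet_le`), independence and Tonelli
bound the expectation below by the integral of the positive part of C(n,k+1) q_k - C(n,k+2) q_{k+1}
- C(n,k) q_{k-1}. The window runs from ř_{k-1}(a/n) to ř_k((k+2)/(2n)). In it r_k ≤ (k+2)/(2n), so
the second term is at most half of the first; and r_{k-1} > a/n with a > 2(k+1), so for large n the
third is at most a fixed fraction γ < 1/2 of the first. The integrand is thus at least δ n^{k+1}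
q_k, and the integral at least δ n^{k+1} (Φ_k((k+2)/(2n)) - Ψ_k(a/n)).

For a = (k+2)/(2D') with D < D' < (k+2)/(4(k+1)), the hypothesis at u = a/n gives Ψ_k(a/n) ≤ B⁻¹
Φ_k((k+2)/(2n)). What remains is at least (1 - B⁻¹) Φ_k(1/n). -/

noncomputable section

namespace LifetimeSum

/-! ### Bases adapted to two filtrations -/

section Adapted

variable {K W ι : Type*} [Field K] [AddCommGroup W] [Module K W]

/-- Induction step for adapted bases: enlarging `H'` by `v` either adds nothing to the trace of `A`,
or `v` lies in `A` and can be subtracted off within `A`. -/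
theorem inf_le_span_insert {A H H' : Submodule K W} {s : Set W} {v : W}
    (hH : H ≤ H' ⊔ K ∙ v) (h : A ⊓ H' ≤ Submodule.span K (s ∩ A))
    (hv : A ⊓ H ≤ H' ∨ v ∈ A) : A ⊓ H ≤ Submodule.span K (insert v s ∩ A) := by
  have hs : Submodule.span K (s ∩ A) ≤ Submodule.span K (insert v s ∩ A) :=
    Submodule.span_mono (Set.inter_subset_inter_left _ (Set.subset_insert _ _))
  rcases hv with hv | hv
  · exact fun x hx => hs (h ⟨hx.1, hv hx⟩)
  · rintro x ⟨hxA, hxH⟩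
    obtain ⟨y, hy, z, hz, rfl⟩ := Submodule.mem_sup.1 (hH hxH)
    obtain ⟨c, rfl⟩ := Submodule.mem_span_singleton.1 hz
    have hyA : y ∈ A := by
      have := A.sub_mem hxA (A.smul_mem c hv)
      rwa [add_sub_cancel_right] at this
    exact add_mem (hs (h ⟨hyA, hy⟩))
      (Submodule.smul_mem _ _ (Submodule.subset_span ⟨Set.mem_insert _ _, hv⟩))

variable [FiniteDimensional K W] [LinearOrder ι]

/-- Take `v` in the smallest `G j` that meets `H` outside `H'`; every other such `G j` contains it.
-/
theorem exists_mem_notMem_adapted {G : ι → Submodule K W} (hG : Monotone G)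
    {H' H : Submodule K W} (h : H' < H) :
    ∃ v ∈ H, v ∉ H' ∧ ∀ j, G j ⊓ H ≤ H' ∨ v ∈ G j := by
  by_cases hall : ∀ j, G j ⊓ H ≤ H'
  · obtain ⟨v, hv, hv'⟩ := SetLike.exists_of_lt h
    exact ⟨v, hv, hv', fun j => Or.inl (hall j)⟩
  · push Not at hall
    obtain ⟨A, ⟨i, hi, rfl⟩, hmin⟩ := WellFounded.has_min
      (wellFounded_lt (α := Submodule K W)) (G '' {j | ¬ G j ⊓ H ≤ H'})
      (Set.Nonempty.image _ hall)
    obtain ⟨v, hv, hv'⟩ := SetLike.not_le_iff_exists.1 hi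
    refine ⟨v, hv.2, hv', fun j => ?_⟩
    by_cases hj : G j ⊓ H ≤ H'
    · exact Or.inl hj
    · right
      rcases le_total i j with hij | hij
      · exact hG hij hv.1
      · rcases (hG hij).eq_or_lt with he | hl
        · exact he ▸ hv.1
        · exact absurd hl (hmin _ ⟨j, hj, rfl⟩)

/-- The traces `F i ⊓ H` properly contained in `H` form a chain; a hyperplane containing the largest
of them works. -/
theorem exists_covBy_adapted {F : ι → Submodule K W} (hF : Monotone F)
    {H : Submodule K W} (h : H ≠ ⊥) :
    ∃ H', H' ⋖ H ∧ ∀ i, F i ⊓ H ≤ H' ∨ H ≤ F i := by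
  obtain ⟨M, hM, hMi⟩ : ∃ M < H, ∀ i, F i ⊓ H ≤ M ∨ H ≤ F i := by
    by_cases hall : ∀ i, H ≤ F i
    · exact ⟨⊥, bot_lt_iff_ne_bot.2 h, fun i => Or.inr (hall i)⟩
    · push Not at hall
      obtain ⟨A, ⟨i, hi, rfl⟩, hmax⟩ := WellFounded.has_min
        (wellFounded_gt (α := Submodule K W)) ((fun i => F i ⊓ H) '' {j | ¬ H ≤ F j})
        (Set.Nonempty.image _ hall)
      refine ⟨F i ⊓ H, lt_of_le_of_ne inf_le_right fun he => hi (inf_eq_right.1 he), fun j => ?_⟩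
      by_cases hj : H ≤ F j
      · exact Or.inr hj
      · left
        rcases le_total j i with hij | hij
        · exact inf_le_inf_right _ (hF hij)
        · rcases (inf_le_inf_right H (hF hij)).eq_or_lt with he | hl
          · exact he.ge
          · exact absurd hl (hmax _ ⟨j, hj, rfl⟩)
  obtain ⟨H', h1, h2⟩ := exists_le_covBy_of_lt hM
  exact ⟨H', h2, fun i => (hMi i).imp_left fun h => h.trans h1⟩

/-- Two filtrations of a finite-dimensional vector space have a common adapted basis. -/
theorem exists_adapted_set {F G : ι → Submodule K W} (hF : Monotone F) (hG : Monotone G)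
    (H : Submodule K W) :
    ∃ s : Set W, LinearIndepOn K id s ∧ Submodule.span K s = H ∧
      ∀ i, F i ⊓ H ≤ Submodule.span K (s ∩ F i) ∧ G i ⊓ H ≤ Submodule.span K (s ∩ G i) := by
  induction H using WellFoundedLT.induction with
  | ind H ih =>
    by_cases hH : H = ⊥
    · subst hH
      exact ⟨∅, linearIndepOn_empty _ _, by simp, by simp⟩
    · obtain ⟨H', hcov, hF'⟩ := exists_covBy_adapted hF hH
      obtain ⟨v, hv, hv', hG'⟩ := exists_mem_notMem_adapted hG hcov.lt
      obtain ⟨s, hs, hspan, hi⟩ := ih H' hcov.lt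
      have hsup : H' ⊔ K ∙ v = H := by
        refine (hcov.eq_or_eq le_sup_left
          (sup_le hcov.le ((Submodule.span_singleton_le_iff_mem _ _).2 hv))).resolve_left ?_
        intro he
        exact hv' (he ▸ (le_sup_right : K ∙ v ≤ H' ⊔ K ∙ v) (Submodule.mem_span_singleton_self v))
      refine ⟨insert v s, hs.id_insert (by rwa [hspan]), ?_, fun i => ⟨?_, ?_⟩⟩
      · rw [Submodule.span_insert, hspan, sup_comm, hsup]
      · exact inf_le_span_insert hsup.ge (hi i).1 ((hF' i).imp_right fun h => h hv)
      · exact inf_le_span_insert hsup.ge (hi i).2 (hG' i)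

/-- Two filtrations of a finite-dimensional vector space have a common adapted basis. -/
theorem exists_adapted_basis {F G : ι → Submodule K W} (hF : Monotone F) (hG : Monotone G) :
    ∃ (m : ℕ) (b : Module.Basis (Fin m) K W),
      (∀ i, ∀ x ∈ F i, ∀ j, b j ∉ F i → b.repr x j = 0) ∧
      (∀ i, ∀ x ∈ G i, ∀ j, b j ∉ G i → b.repr x j = 0) := by
  classical
  obtain ⟨s, hs, hspan, hi⟩ := exists_adapted_set hF hG ⊤
  let b' : Module.Basis s K W := Module.Basis.mk hs (by simp [hspan])
  have hb' : ∀ j, b' j = j := fun j => by simp [b']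
  have : Finite s := Module.Finite.finite_basis b'
  obtain ⟨m, ⟨e⟩⟩ := Finite.exists_equiv_fin s
  have key : ∀ A : Submodule K W, A ⊓ ⊤ ≤ Submodule.span K (s ∩ A) →
      ∀ x ∈ A, ∀ j, (b'.reindex e) j ∉ A → (b'.reindex e).repr x j = 0 := by
    intro A hA x hx j hj
    have hx' := hA ⟨hx, trivial⟩
    rw [Module.Basis.repr_reindex_apply]
    rw [Module.Basis.reindex_apply, hb'] at hj
    clear hx
    induction hx' using Submodule.span_induction with
    | mem y hy =>
      have hyb : y = b' ⟨y, hy.1⟩ := (hb' ⟨y, hy.1⟩).symm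
      rw [hyb, Module.Basis.repr_self, Finsupp.single_apply, if_neg]
      intro he
      exact hj (he ▸ hy.2)
    | zero => simp
    | add y z _ _ h1 h2 => simp [h1, h2]
    | smul c y _ h1 => simp [h1]
  exact ⟨m, b'.reindex e, fun i => key _ (hi i).1, fun i => key _ (hi i).2⟩

end Adapted

variable {n : ℕ}

/-! ### Existence of barcodes and the integral of Betti numbers -/

section Barcode

/-- Right-continuity: only finitely many times are involved, and those exceeding `s` still exceed
`t` for `t` slightly larger. It makes the bars closed on the left and open on the right. -/
theorem exists_gt_complexProcess_le (u : {σ : Finset (Fin n) // σ.Nonempty} → ℝ) (s : ℝ≥0) :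
    ∃ t, s < t ∧ complexProcess u t ≤ complexProcess u s := by
  have h : ∀ τ, ∀ᶠ t : ℝ≥0 in nhdsWithin s (Set.Ioi s), u τ ≤ t → u τ ≤ s := by
    intro τ
    by_cases hτ : u τ ≤ s
    · exact Eventually.of_forall fun _ _ => hτ
    · push Not at hτ
      have hc : Tendsto (fun t : ℝ≥0 => (t : ℝ)) (nhdsWithin s (Set.Ioi s)) (nhds (s : ℝ)) :=
        (NNReal.continuous_coe.tendsto s).mono_left nhdsWithin_le_nhds
      filter_upwards [hc.eventually_lt_const hτ] with t ht ht'
      exact absurd ht' (not_le.2 ht)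
  obtain ⟨t, ht, hst⟩ := ((eventually_all.2 h).and self_mem_nhdsWithin).exists
  exact ⟨t, hst, fun σ hσ => ⟨hσ.1, fun τ hτ => ht τ (hσ.2 τ hτ)⟩⟩

theorem sInf_le_iff_mem {A : Set ℝ≥0} (hne : A.Nonempty) (hup : IsUpperSet A)
    (hA : ∀ s, ∃ t, s < t ∧ (t ∈ A → s ∈ A)) (x : ℝ≥0) : sInf A ≤ x ↔ x ∈ A := by
  refine ⟨fun h => ?_, fun h => csInf_le (OrderBot.bddBelow A) h⟩
  obtain ⟨t, ht, htA⟩ := hA (sInf A)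
  obtain ⟨a, ha, hat⟩ := (csInf_lt_iff (OrderBot.bddBelow A) hne).1 ht
  exact hup h (htA (hup hat.le ha))

theorem lt_iInf_coe_iff_notMem {A : Set ℝ≥0} (hup : IsUpperSet A)
    (hA : ∀ s, ∃ t, s < t ∧ (t ∈ A → s ∈ A)) (x : ℝ≥0) :
    (x : ℝ≥0∞) < ⨅ a ∈ A, (a : ℝ≥0∞) ↔ x ∉ A := by
  refine ⟨fun h hx => ?_, fun h => ?_⟩
  · exact not_le.2 h (iInf₂_le (f := fun (a : ℝ≥0) (_ : a ∈ A) => (a : ℝ≥0∞)) x hx)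
  obtain ⟨t, ht, htA⟩ := hA x
  refine (ENNReal.coe_lt_coe.2 ht).trans_le (le_iInf₂ fun a ha => ENNReal.coe_le_coe.2 ?_)
  by_contra! hat
  exact h (htA (hup hat.le ha))

theorem nonempty_barcode (X : ℝ≥0 →o PreAbstractSimplicialComplex (Fin n))
    (hX : ∀ s, ∃ t, s < t ∧ X t ≤ X s) (k : ℕ) : Nonempty (Barcode X k) := by
  classical
  have hZ : Monotone fun t => cycles (X t) k := fun s t h => cycles_mono (X.monotone h) k
  -- Intersecting with the cycles avoids proving ∂∂ = 0.
  have hG : Monotone fun t => boundaries (X t) k ⊓ cycles (X t) k :=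
    fun s t h => inf_le_inf (boundaries_mono (X.monotone h) k) (cycles_mono (X.monotone h) k)
  obtain ⟨m, b, hbZ, hbG⟩ := exists_adapted_basis hZ hG
  have rightZ : ∀ j s, ∃ t, s < t ∧
      (t ∈ {t | b j ∈ cycles (X t) k} → s ∈ {t | b j ∈ cycles (X t) k}) := fun j s => by
    obtain ⟨t, hst, h⟩ := hX s
    exact ⟨t, hst, fun h' => cycles_mono h k h'⟩
  have rightG : ∀ j s, ∃ t, s < t ∧ (t ∈ {t | b j ∈ boundaries (X t) k ⊓ cycles (X t) k} →
      s ∈ {t | b j ∈ boundaries (X t) k ⊓ cycles (X t) k}) := fun j s => by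
    obtain ⟨t, hst, h⟩ := hX s
    exact ⟨t, hst, fun h' => ⟨boundaries_mono h k h'.1, cycles_mono h k h'.2⟩⟩
  -- Basis vectors that are at some time a cycle but not a boundary: each gives one bar, from the
  -- time it becomes a cycle until it becomes a boundary (∞ if never).
  let J := {j : Fin m // ∃ t, b j ∈ cycles (X t) k ∧ b j ∉ boundaries (X t) k ⊓ cycles (X t) k}
  let e : Fin (Fintype.card J) ≃ J := (Fintype.equivFin J).symm
  let birth : Fin (Fintype.card J) → ℝ≥0 := fun i => sInf {t | b (e i).1 ∈ cycles (X t) k}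
  let death : Fin (Fintype.card J) → ℝ≥0∞ := fun i =>
    ⨅ a ∈ {t | b (e i).1 ∈ boundaries (X t) k ⊓ cycles (X t) k}, (a : ℝ≥0∞)
  have hbirth : ∀ i t, birth i ≤ t ↔ b (e i).1 ∈ cycles (X t) k := fun i t =>
    sInf_le_iff_mem ⟨_, (e i).2.choose_spec.1⟩ (fun _ _ h h' => hZ h h') (rightZ _) t
  have hdeath : ∀ i (t : ℝ≥0), (t : ℝ≥0∞) < death i ↔
      b (e i).1 ∉ boundaries (X t) k ⊓ cycles (X t) k := fun i t =>
    lt_iInf_coe_iff_notMem (fun _ _ h h' => hG h h') (rightG _) t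
  let f : ∀ t : ℝ≥0, cycles (X t) k →ₗ[ℝ]
      ({i : Fin (Fintype.card J) // birth i ≤ t ∧ (t : ℝ≥0∞) < death i} → ℝ) := fun t =>
    LinearMap.pi fun i => b.coord (e i.1).1 ∘ₗ (cycles (X t) k).subtype
  have hf : ∀ t x i, f t x i = b.repr x.1 (e i.1).1 := fun t x i => rfl
  have hker : ∀ t, (boundaries (X t) k).submoduleOf (cycles (X t) k) = LinearMap.ker (f t) := by
    intro t
    ext x
    rw [LinearMap.mem_ker, Submodule.submoduleOf, Submodule.mem_comap, Submodule.subtype_apply]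
    constructor
    · intro hx
      ext i
      rw [hf]
      exact hbG t _ ⟨hx, x.2⟩ _ ((hdeath _ _).1 i.2.2)
    · intro hx
      suffices x.1 ∈ boundaries (X t) k ⊓ cycles (X t) k from this.1
      rw [← b.sum_repr x.1]
      refine Submodule.sum_mem _ fun j _ => ?_
      by_cases hj : b j ∈ boundaries (X t) k ⊓ cycles (X t) k
      · exact Submodule.smul_mem _ _ hj
      -- If `b j` is a cycle at `t`, its bar is alive and the coordinate is one of those of `f t`;
      -- otherwise it vanishes by adaptedness.
      · suffices b.repr x.1 j = 0 by simp [this]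
        by_cases hj' : b j ∈ cycles (X t) k
        · obtain ⟨i, hi⟩ := e.surjective ⟨j, t, hj', hj⟩
          have hij : (e i).1 = j := congrArg Subtype.val hi
          have := congrFun hx ⟨i, (hbirth i t).2 (hij ▸ hj'), (hdeath i t).2 (hij ▸ hj)⟩
          rw [hf, Pi.zero_apply] at this
          simpa only [hij] using this
        · exact hbZ t _ x.2 _ hj'
  have hsurj : ∀ t, Function.Surjective (f t) := by
    intro t y
    refine ⟨⟨∑ i, y i • b (e i.1).1, Submodule.sum_mem _ fun i _ =>
      Submodule.smul_mem _ _ ((hbirth _ _).1 i.2.1)⟩, ?_⟩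
    ext i
    rw [hf]
    simp only [map_sum, map_smul, Module.Basis.repr_self, Finsupp.coe_finsetSum, Finset.sum_apply,
      Finsupp.smul_apply, Finsupp.single_apply, smul_eq_mul, mul_ite, mul_one, mul_zero]
    rw [Finset.sum_eq_single i]
    · simp
    · intro j _ hj
      rw [if_neg]
      intro h
      exact hj (Subtype.ext (e.injective (Subtype.ext h)))
    · simp
  let iso : ∀ t : ℝ≥0, Homology (X t) k ≃ₗ[ℝ]
      ({i : Fin (Fintype.card J) // birth i ≤ t ∧ (t : ℝ≥0∞) < death i} → ℝ) := fun t =>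
    LinearEquiv.ofBijective (Submodule.liftQ _ (f t) (hker t).le)
      ⟨LinearMap.ker_eq_bot.1 (Submodule.ker_liftQ_eq_bot' _ _ (hker t)), fun y => by
        obtain ⟨x, hx⟩ := hsurj t y
        exact ⟨Submodule.Quotient.mk x, hx⟩⟩
  refine ⟨⟨Fintype.card J, birth, death, fun i => ?_, iso, ?_⟩⟩
  · obtain ⟨t, h1, h2⟩ := (e i).2
    exact (ENNReal.coe_le_coe.2 ((hbirth i t).2 h1)).trans_lt ((hdeath i t).2 h2)
  · intro s t hst x i
    obtain ⟨x, rfl⟩ := Submodule.Quotient.mk_surjective _ x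
    have h1 : iso t (homologyMap (X.monotone hst) k (Submodule.Quotient.mk x)) i =
        b.repr x.1 (e i.1).1 := rfl
    rw [h1]
    split_ifs with hs
    · rfl
    · exact hbZ s _ x.2 _ fun h => hs ((hbirth _ _).2 h)

theorem Barcode.finrank_homology {X : ℝ≥0 →o PreAbstractSimplicialComplex (Fin n)} {k : ℕ}
    (β : Barcode X k) (t : ℝ≥0) :
    (Module.finrank ℝ (Homology (X t) k) : ℝ≥0∞) =
      ∑ i, {t : ℝ≥0 | β.birth i ≤ t ∧ (t : ℝ≥0∞) < β.death i}.indicator (fun _ => 1) t := by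
  classical
  rw [(β.iso t).finrank_eq, Module.finrank_fintype_fun_eq_card, Fintype.card_subtype]
  simp [Set.indicator_apply]

theorem lintegral_indicator_le (b : ℝ≥0) (d : ℝ≥0∞) (s s' : ℝ) (T : ℝ≥0) (hs : 0 ≤ s)
    (hs' : s' ≤ T) :
    ∫⁻ t in Set.Ioc s s', {t : ℝ≥0 | b ≤ t ∧ (t : ℝ≥0∞) < d}.indicator (fun _ => 1) t.toNNReal ≤
      min d T - min (b : ℝ≥0∞) T := by
  have hm : MeasurableSet {t : ℝ | b ≤ t.toNNReal ∧ (t.toNNReal : ℝ≥0∞) < d} :=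
    (measurableSet_le measurable_const measurable_real_toNNReal).inter
      (measurableSet_lt measurable_real_toNNReal.coe_nnreal_ennreal measurable_const)
  have h1 : ∫⁻ t in Set.Ioc s s', {t : ℝ≥0 | b ≤ t ∧ (t : ℝ≥0∞) < d}.indicator (fun _ => 1)
      t.toNNReal = volume ({t : ℝ | b ≤ t.toNNReal ∧ (t.toNNReal : ℝ≥0∞) < d} ∩ Set.Ioc s s') := by
    rw [← Measure.restrict_apply hm, ← lintegral_indicator_one hm]
    rfl
  rw [h1]
  have hfin : min d (T : ℝ≥0∞) ≠ ∞ := ((min_le_right _ _).trans_lt ENNReal.coe_lt_top).ne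
  by_cases hbT : b ≤ T
  · have hsub : {t : ℝ | b ≤ t.toNNReal ∧ (t.toNNReal : ℝ≥0∞) < d} ∩ Set.Ioc s s' ⊆
        Set.Icc (b : ℝ) (min d (T : ℝ≥0∞)).toReal := by
      rintro t ⟨⟨ht1, ht2⟩, ht3, ht4⟩
      have ht0 : 0 ≤ t := hs.trans ht3.le
      refine ⟨by simpa [Real.coe_toNNReal _ ht0] using NNReal.coe_le_coe.2 ht1, ?_⟩
      rw [← ENNReal.ofReal_le_iff_le_toReal hfin]
      refine le_min ht2.le ?_
      rw [ENNReal.ofReal_le_iff_le_toReal ENNReal.coe_ne_top]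
      exact ht4.trans hs'
    refine (measure_mono hsub).trans ?_
    rw [Real.volume_Icc, min_eq_left (ENNReal.coe_le_coe.2 hbT),
      ENNReal.ofReal_sub _ b.coe_nonneg, ENNReal.ofReal_toReal hfin, ENNReal.ofReal_coe_nnreal]
  · have hsub : {t : ℝ | b ≤ t.toNNReal ∧ (t.toNNReal : ℝ≥0∞) < d} ∩ Set.Ioc s s' = ∅ := by
      ext t
      simp only [Set.mem_inter_iff, Set.mem_ofPred_eq, Set.mem_Ioc, Set.mem_empty_iff_false,
        iff_false]
      rintro ⟨⟨ht1, -⟩, -, ht4⟩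
      exact hbT (ht1.trans (Real.toNNReal_le_iff_le_coe.2 (ht4.trans hs')))
    simp [hsub]

theorem lintegral_finrank_homology_le_lifetimeSumUntil
    (X : ℝ≥0 →o PreAbstractSimplicialComplex (Fin n)) (hX : ∀ s, ∃ t, s < t ∧ X t ≤ X s) (k : ℕ)
    {s s' : ℝ} {T : ℝ≥0} (hs : 0 ≤ s) (hs' : s' ≤ T) :
    ∫⁻ t in Set.Ioc s s', (Module.finrank ℝ (Homology (X t.toNNReal) k) : ℝ≥0∞) ≤
      lifetimeSumUntil X k T := by
  obtain ⟨β⟩ := nonempty_barcode X hX k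
  refine le_trans ?_ (le_iSup _ β)
  simp_rw [β.finrank_homology]
  rw [lintegral_finsetSum]
  · exact Finset.sum_le_sum fun i _ => lintegral_indicator_le _ _ _ _ _ hs hs'
  · intro i _
    refine (measurable_const.indicator (s := {t : ℝ≥0 | β.birth i ≤ t ∧ (t : ℝ≥0∞) < β.death i})
      ?_).comp measurable_real_toNNReal
    exact (measurableSet_le measurable_const measurable_id).inter
      (measurableSet_lt measurable_coe_nnreal_ennreal measurable_const)

theorem lifetimeSumUntil_le_lifetimeSum (X : ℝ≥0 →o PreAbstractSimplicialComplex (Fin n)) (k : ℕ)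
    (T : ℝ≥0) : lifetimeSumUntil X k T ≤ lifetimeSum X k := by
  refine iSup_mono fun β => Finset.sum_le_sum fun i _ => ?_
  rcases le_total (β.birth i : ℝ≥0∞) T with h | h
  · rw [min_eq_left h]
    exact tsub_le_tsub_right (min_le_left _ _) _
  · rw [min_eq_right h, tsub_eq_zero_of_le (min_le_right _ _)]
    exact zero_le

end Barcode

/-! ### The Morse inequality -/

section Morse

/-- The faces of `X` with `m` vertices; the empty set counts as a face. -/
def faceSet (X : PreAbstractSimplicialComplex (Fin n)) (m : ℕ) : Set (Finset (Fin n)) :=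
  {σ | (σ = ∅ ∨ σ ∈ X) ∧ σ.card = m}

theorem chains_eq_spanSubset (X : PreAbstractSimplicialComplex (Fin n)) (k : ℕ) :
    chains X k = Pi.spanSubset ℝ (faceSet X (k + 1)) := by
  ext f
  rw [Pi.mem_spanSubset_iff]
  constructor
  · intro h σ hσ
    by_contra h0
    exact hσ ⟨Or.inr (h σ h0).1, (h σ h0).2⟩
  · intro h σ hσ
    have h1 : σ ∈ faceSet X (k + 1) := by
      by_contra h0
      exact hσ (h σ h0)
    refine ⟨h1.1.resolve_left ?_, h1.2⟩
    rintro rfl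
    simpa using h1.2

theorem map_boundary_chains_le (X : PreAbstractSimplicialComplex (Fin n)) (k : ℕ) :
    (chains X k).map (boundary n) ≤ Pi.spanSubset ℝ (faceSet X k) := by
  rintro _ ⟨f, hf, rfl⟩
  rw [boundary, Fintype.linearCombination_apply]
  refine Submodule.sum_mem _ fun σ _ => ?_
  by_cases h0 : f σ = 0
  · simp [h0]
  · refine Submodule.smul_mem _ _ (Submodule.sum_mem _ fun v hv => ?_)
    obtain ⟨hσ, hcard⟩ := hf σ h0
    have hmem : σ.erase v ∈ faceSet X k := by
      refine ⟨?_, by rw [Finset.card_erase_of_mem hv, hcard, Nat.add_sub_cancel]⟩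
      rcases (σ.erase v).eq_empty_or_nonempty with h | h
      · exact Or.inl h
      · exact Or.inr ((X.isRelLowerSet_faces hσ).2 (Finset.erase_subset v σ) h)
    rw [Pi.mem_spanSubset_iff]
    intro ρ hρ
    refine Pi.single_eq_of_ne ?_ _
    rintro rfl
    exact hρ hmem

/-- A Morse inequality. -/
theorem ncard_faceSet_le (X : PreAbstractSimplicialComplex (Fin n)) (k : ℕ) :
    (faceSet X (k + 1)).ncard ≤
      Module.finrank ℝ (Homology X k) + (faceSet X (k + 2)).ncard + (faceSet X k).ncard := by
  -- Rank-nullity: f_k = rank ∂_k + dim Z_k, with rank ∂_k ≤ f_{k-1} and dim Z_k ≤ dim H_k +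
  -- f_{k+1}.
  have h1 := LinearMap.finrank_range_add_finrank_ker ((boundary n).domRestrict (chains X k))
  rw [chains_eq_spanSubset, Pi.dim_spanSubset, ← chains_eq_spanSubset,
    LinearMap.range_domRestrict, LinearMap.ker_domRestrict] at h1
  have h2 : Module.finrank ℝ (cycles X k) =
      Module.finrank ℝ ((LinearMap.ker (boundary n)).comap (chains X k).subtype) := by
    rw [cycles, ← Submodule.map_comap_subtype, Submodule.finrank_map_subtype_eq]
  have h3 := Submodule.finrank_mono (map_boundary_chains_le X k)
  rw [Pi.dim_spanSubset] at h3
  have h4 : Module.finrank ℝ (boundaries X k) ≤ (faceSet X (k + 2)).ncard := by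
    rw [← Pi.dim_spanSubset (R := ℝ), ← chains_eq_spanSubset]
    exact Submodule.finrank_map_le _ _
  have h5 := Submodule.finrank_quotient_add_finrank
    ((boundaries X k).submoduleOf (cycles X k))
  have h6 : Module.finrank ℝ ((boundaries X k).submoduleOf (cycles X k)) ≤
      Module.finrank ℝ (boundaries X k) := by
    rw [Submodule.submoduleOf, ← Submodule.finrank_map_subtype_eq, Submodule.map_comap_subtype]
    exact Submodule.finrank_mono inf_le_right
  change _ + Module.finrank ℝ ((LinearMap.ker (boundary n)).comap (chains X k).subtype) = _ at h1
  rw [← h2] at h1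
  change _ ≤ Module.finrank ℝ (cycles X k ⧸ (boundaries X k).submoduleOf (cycles X k)) + _ + _
  omega

end Morse

/-! ### Monotonicity of q, r, Q and the generalized inverses -/

section Functions

variable {p : ℕ → ℝ → ℝ}

theorem q_nonneg (h0 : ∀ j t, 0 ≤ p j t) (m : ℕ) (t : ℝ) : 0 ≤ q p m t :=
  Finset.prod_nonneg fun _ _ => pow_nonneg (h0 _ _) _

theorem q_mono (h0 : ∀ j t, 0 ≤ p j t) (hmono : ∀ j, Monotone (p j)) (m : ℕ) :
    Monotone (q p m) := fun _ _ hst =>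
  Finset.prod_le_prod (fun _ _ => pow_nonneg (h0 _ _) _) fun _ _ =>
    pow_le_pow_left₀ (h0 _ _) (hmono _ hst) _

theorem tendsto_q (hlim : ∀ j, Tendsto (p j) atTop (nhds 1)) (m : ℕ) :
    Tendsto (q p m) atTop (nhds 1) := by
  have := tendsto_finsetProd (Finset.range m) fun i _ => (hlim i).pow (m.choose (i + 1))
  simp only [one_pow, Finset.prod_const_one] at this
  exact this

theorem q_succ (m : ℕ) (t : ℝ) :
    q p (m + 1) t = q p m t * ∏ i ∈ Finset.range (m + 1), p i t ^ m.choose i := by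
  -- The extra factor `i = m` has exponent zero; Pascal's rule then splits the exponents.
  have : q p m t = ∏ i ∈ Finset.range (m + 1), p i t ^ m.choose (i + 1) := by
    rw [Finset.prod_range_succ, Nat.choose_succ_self, pow_zero, mul_one, q]
  rw [this, ← Finset.prod_mul_distrib, q]
  refine Finset.prod_congr rfl fun i _ => ?_
  rw [Nat.choose_succ_succ, pow_add, mul_comm]

theorem r_mul_q (m : ℕ) (t : ℝ) : r p m t * q p m t = q p (m + 1) t := by
  by_cases h : q p m t = 0
  · rw [q_succ, h, mul_zero, zero_mul]
  · rw [r, div_mul_cancel₀ _ h]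

theorem r_eq_prod {m : ℕ} {t : ℝ} (h : q p m t ≠ 0) :
    r p m t = ∏ i ∈ Finset.range (m + 1), p i t ^ m.choose i := by
  rw [r, q_succ, mul_div_cancel_left₀ _ h]

/-- Where the denominator is nonzero, r is a product of powers of the `p i`; where it vanishes, r is
0 by convention. -/
theorem r_mono (h0 : ∀ j t, 0 ≤ p j t) (hmono : ∀ j, Monotone (p j)) (m : ℕ) :
    Monotone (r p m) := by
  intro s t hst
  by_cases h : q p m s = 0
  · rw [r, h, div_zero]
    exact div_nonneg (q_nonneg h0 _ _) (q_nonneg h0 _ _)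
  · have ht : q p m t ≠ 0 :=
      (((q_nonneg h0 m s).lt_of_ne' h).trans_le (q_mono h0 hmono m hst)).ne'
    rw [r_eq_prod h, r_eq_prod ht]
    exact Finset.prod_le_prod (fun _ _ => pow_nonneg (h0 _ _) _) fun _ _ =>
      pow_le_pow_left₀ (h0 _ _) (hmono _ hst) _

theorem tendsto_r (hlim : ∀ j, Tendsto (p j) atTop (nhds 1)) (m : ℕ) :
    Tendsto (r p m) atTop (nhds 1) := by
  have := (tendsto_q hlim (m + 1)).div (tendsto_q hlim m) one_ne_zero
  rwa [div_one] at this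

theorem exists_lt_r (hlim : ∀ j, Tendsto (p j) atTop (nhds 1)) (m : ℕ) {x : ℝ} (hx : x < 1) :
    {t : ℝ | 0 ≤ t ∧ x < r p m t}.Nonempty := by
  obtain ⟨t, ht, ht0⟩ :=
    (((tendsto_r hlim m).eventually_const_lt hx).and (eventually_ge_atTop 0)).exists
  exact ⟨t, ht0, ht⟩

theorem bddBelow_lt_r (m : ℕ) (x : ℝ) : BddBelow {t : ℝ | 0 ≤ t ∧ x < r p m t} :=
  ⟨0, fun _ h => h.1⟩

theorem rInv_nonneg (m : ℕ) (x : ℝ) : 0 ≤ rInv p m x :=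
  Real.sInf_nonneg fun _ h => h.1

theorem rInv_mono (hlim : ∀ j, Tendsto (p j) atTop (nhds 1)) (m : ℕ) {x y : ℝ} (hxy : x ≤ y)
    (hy : y < 1) : rInv p m x ≤ rInv p m y :=
  csInf_le_csInf (bddBelow_lt_r m x) (exists_lt_r hlim m hy) fun _ h => ⟨h.1, hxy.trans_lt h.2⟩

theorem lt_r_of_rInv_lt (h0 : ∀ j t, 0 ≤ p j t) (hmono : ∀ j, Monotone (p j))
    (hlim : ∀ j, Tendsto (p j) atTop (nhds 1)) {m : ℕ} {x t : ℝ} (hx : x < 1)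
    (h : rInv p m x < t) : x < r p m t := by
  obtain ⟨s, hs, hst⟩ := (csInf_lt_iff (bddBelow_lt_r m x) (exists_lt_r hlim m hx)).1 h
  exact hs.2.trans_le (r_mono h0 hmono m hst.le)

theorem r_le_of_lt_rInv {m : ℕ} {x t : ℝ} (ht : 0 ≤ t) (h : t < rInv p m x) : r p m t ≤ x := by
  by_contra! hx
  exact notMem_of_lt_csInf h (bddBelow_lt_r m x) ⟨ht, hx⟩

/-- This is where T > ř_k(0) enters: it keeps the window inside [0, T] for large n. -/
theorem exists_forall_lt_rInv_lt (h0 : ∀ j t, 0 ≤ p j t) (hmono : ∀ j, Monotone (p j))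
    (hlim : ∀ j, Tendsto (p j) atTop (nhds 1)) {m : ℕ} {T : ℝ} (hT : rInv p m 0 < T) :
    ∃ δ > 0, ∀ x < δ, rInv p m x ≤ T := by
  obtain ⟨t, h1, h2⟩ := exists_between hT
  refine ⟨r p m t, lt_r_of_rInv_lt h0 hmono hlim one_pos h1, fun x hx => ?_⟩
  exact (csInf_le (bddBelow_lt_r m x) ⟨(rInv_nonneg m 0).trans h1.le, hx⟩).trans h2.le

theorem Q_sub_Q (h0 : ∀ j t, 0 ≤ p j t) (hmono : ∀ j, Monotone (p j)) (k : ℕ) (s t : ℝ) :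
    Q p k t - Q p k s = ∫ x in s..t, q p (k + 1) x :=
  intervalIntegral.integral_interval_sub_left (q_mono h0 hmono _).intervalIntegrable
    (q_mono h0 hmono _).intervalIntegrable

theorem Q_mono (h0 : ∀ j t, 0 ≤ p j t) (hmono : ∀ j, Monotone (p j)) (k : ℕ) :
    Monotone (Q p k) := fun s t hst => by
  rw [← sub_nonneg, Q_sub_Q h0 hmono]
  exact intervalIntegral.integral_nonneg hst fun x _ => q_nonneg h0 _ x

theorem Phi_mono (h0 : ∀ j t, 0 ≤ p j t) (hmono : ∀ j, Monotone (p j))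
    (hlim : ∀ j, Tendsto (p j) atTop (nhds 1)) (k : ℕ) {x y : ℝ} (hxy : x ≤ y) (hy : y < 1) :
    Phi p k x ≤ Phi p k y :=
  Q_mono h0 hmono k (rInv_mono hlim (k + 1) hxy hy)

end Functions

/-! ### Expected face numbers -/

section Probability

variable {Ω : Type*}

/-- Group the nonempty subsets of `σ` by size. By independence the product is the probability that
`σ` is present at time `t`. -/
theorem prod_subtype_powerset_eq_q (p : ℕ → ℝ → ℝ) (σ : Finset (Fin n)) (t : ℝ) :
    ∏ τ ∈ σ.powerset.subtype Finset.Nonempty, p (τ.1.card - 1) t = q p σ.card t := by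
  classical
  rw [Finset.prod_subtype_eq_prod_filter (f := fun τ : Finset (Fin n) => p (τ.card - 1) t),
    Finset.prod_filter,
    Finset.prod_powerset, Finset.prod_range_succ', q]
  simp only [Finset.powersetCard_zero, Finset.prod_singleton, Finset.not_nonempty_empty, if_false,
    mul_one]
  refine Finset.prod_congr rfl fun j _ => ?_
  rw [← Finset.card_powersetCard, ← Finset.prod_const]
  refine Finset.prod_congr rfl fun τ hτ => ?_
  have hc := (Finset.mem_powersetCard.1 hτ).2
  rw [if_pos (Finset.card_pos.1 (by omega)), hc, Nat.add_sub_cancel]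

/-- The number of sets of `m` vertices all of whose nonempty subsets `τ` have `u τ ω ≤ t`. -/
def faceNum (u : {σ : Finset (Fin n) // σ.Nonempty} → Ω → ℝ) (m : ℕ) (ω : Ω) (t : ℝ) : ℝ :=
  ∑ σ ∈ Finset.powersetCard m (Finset.univ : Finset (Fin n)),
    {z : Ω × ℝ | ∀ τ : {τ : Finset (Fin n) // τ.Nonempty}, τ.1 ⊆ σ → u τ z.1 ≤ z.2}.indicator
      (fun _ => (1 : ℝ)) (ω, t)

theorem faceNum_eq_ncard (u : {σ : Finset (Fin n) // σ.Nonempty} → Ω → ℝ) (m : ℕ) (ω : Ω) {t : ℝ}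
    (ht : 0 ≤ t) : faceNum u m ω t =
      (faceSet (complexProcess (fun σ => u σ ω) t.toNNReal) m).ncard := by
  classical
  have h : faceSet (complexProcess (fun σ => u σ ω) t.toNNReal) m =
      ((Finset.powersetCard m (Finset.univ : Finset (Fin n))).filter fun σ =>
        ∀ τ : {τ : Finset (Fin n) // τ.Nonempty}, τ.1 ⊆ σ → u τ ω ≤ t : Finset _) := by
    ext σ
    have hmem : σ ∈ complexProcess (fun σ => u σ ω) t.toNNReal ↔ σ.Nonempty ∧
        ∀ τ : {τ : Finset (Fin n) // τ.Nonempty}, τ.1 ⊆ σ → u τ ω ≤ t := by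
      conv_rhs => rw [← Real.coe_toNNReal t ht]
      rfl
    simp only [faceSet, Set.mem_ofPred_eq, hmem, Finset.coe_filter, Finset.mem_powersetCard,
      Finset.subset_univ, true_and]
    rcases σ.eq_empty_or_nonempty with rfl | hσ
    · have : ∀ τ : {τ : Finset (Fin n) // τ.Nonempty}, τ.1 ⊆ ∅ → u τ ω ≤ t := fun τ hτ =>
        absurd (Finset.subset_empty.1 hτ) τ.2.ne_empty
      simp only [true_or, true_and]
      exact (and_iff_left this).symm
    · simp only [hσ.ne_empty, hσ, false_or, true_and]
      exact and_comm
  rw [h, Set.ncard_coe_finset, Finset.card_filter, Nat.cast_sum, faceNum]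
  refine Finset.sum_congr rfl fun σ _ => ?_
  simp [Set.indicator_apply]

theorem ofReal_faceNum_le_finrank (u : {σ : Finset (Fin n) // σ.Nonempty} → Ω → ℝ) (k : ℕ) (ω : Ω)
    {t : ℝ} (ht : 0 ≤ t) :
    ENNReal.ofReal (faceNum u (k + 1) ω t - faceNum u (k + 2) ω t - faceNum u k ω t) ≤
      Module.finrank ℝ (Homology (complexProcess (fun σ => u σ ω) t.toNNReal) k) := by
  rw [← ENNReal.ofReal_natCast]
  refine ENNReal.ofReal_le_ofReal ?_
  rw [faceNum_eq_ncard u _ ω ht, faceNum_eq_ncard u _ ω ht, faceNum_eq_ncard u _ ω ht]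
  have := ncard_faceSet_le (complexProcess (fun σ => u σ ω) t.toNNReal) k
  have h : ((faceSet (complexProcess (fun σ => u σ ω) t.toNNReal) (k + 1)).ncard : ℝ) ≤
      Module.finrank ℝ (Homology (complexProcess (fun σ => u σ ω) t.toNNReal) k) +
      (faceSet (complexProcess (fun σ => u σ ω) t.toNNReal) (k + 2)).ncard +
      (faceSet (complexProcess (fun σ => u σ ω) t.toNNReal) k).ncard := by
    exact_mod_cast this
  linarith

variable [MeasurableSpace Ω]

theorem ofReal_integral_le_lintegral {P : Measure Ω} {f : Ω → ℝ} (hf : Integrable f P) :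
    ENNReal.ofReal (∫ ω, f ω ∂P) ≤ ∫⁻ ω, ENNReal.ofReal (f ω) ∂P := by
  rw [integral_eq_lintegral_pos_part_sub_lintegral_neg_part hf]
  exact (ENNReal.ofReal_le_ofReal (sub_le_self _ ENNReal.toReal_nonneg)).trans
    ENNReal.ofReal_toReal_le

theorem measure_forall_le_eq_q {P : Measure Ω} [IsProbabilityMeasure P] {p : ℕ → ℝ → ℝ}
    {u : {σ : Finset (Fin n) // σ.Nonempty} → Ω → ℝ} (hmeas : ∀ σ, Measurable (u σ))
    (hindep : iIndepFun u P) (hdist : ∀ σ t, cdf (P.map (u σ)) t = p (σ.1.card - 1) t)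
    (σ : Finset (Fin n)) (t : ℝ) :
    P.real {ω | ∀ τ : {τ : Finset (Fin n) // τ.Nonempty}, τ.1 ⊆ σ → u τ ω ≤ t} =
      q p σ.card t := by
  have hset : {ω | ∀ τ : {τ : Finset (Fin n) // τ.Nonempty}, τ.1 ⊆ σ → u τ ω ≤ t} =
      ⋂ τ ∈ σ.powerset.subtype Finset.Nonempty, u τ ⁻¹' Set.Iic t := by
    ext ω
    simp
  rw [hset, measureReal_def, hindep.measure_inter_preimage_eq_mul _ (fun _ _ => measurableSet_Iic),
    ENNReal.toReal_prod, ← prod_subtype_powerset_eq_q]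
  refine Finset.prod_congr rfl fun τ _ => ?_
  have := Measure.isProbabilityMeasure_map (μ := P) (hmeas τ).aemeasurable
  rw [← hdist, cdf_eq_real, measureReal_def, Measure.map_apply (hmeas τ) measurableSet_Iic]

theorem measurableSet_forall_le {u : {σ : Finset (Fin n) // σ.Nonempty} → Ω → ℝ}
    (hmeas : ∀ σ, Measurable (u σ)) (σ : Finset (Fin n)) :
    MeasurableSet
      {z : Ω × ℝ | ∀ τ : {τ : Finset (Fin n) // τ.Nonempty}, τ.1 ⊆ σ → u τ z.1 ≤ z.2} := by
  simp only [Set.ofPred_forall]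
  exact MeasurableSet.iInter fun τ => MeasurableSet.iInter fun _ =>
    measurableSet_le ((hmeas τ).comp measurable_fst) measurable_snd

theorem measurable_faceNum {u : {σ : Finset (Fin n) // σ.Nonempty} → Ω → ℝ}
    (hmeas : ∀ σ, Measurable (u σ)) (m : ℕ) :
    Measurable fun z : Ω × ℝ => faceNum u m z.1 z.2 :=
  Finset.measurable_fun_sum _ fun σ _ =>
    measurable_const.indicator (measurableSet_forall_le hmeas σ)

theorem integrable_indicator_forall_le {P : Measure Ω} [IsProbabilityMeasure P]
    {u : {σ : Finset (Fin n) // σ.Nonempty} → Ω → ℝ}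
    (hmeas : ∀ σ, Measurable (u σ)) (σ : Finset (Fin n)) (t : ℝ) :
    Integrable (fun ω => {z : Ω × ℝ | ∀ τ : {τ : Finset (Fin n) // τ.Nonempty},
      τ.1 ⊆ σ → u τ z.1 ≤ z.2}.indicator (fun _ => (1 : ℝ)) (ω, t)) P :=
  (integrable_const (1 : ℝ)).indicator
    (measurable_prodMk_right (measurableSet_forall_le hmeas σ))

theorem integrable_faceNum {P : Measure Ω} [IsProbabilityMeasure P]
    {u : {σ : Finset (Fin n) // σ.Nonempty} → Ω → ℝ}
    (hmeas : ∀ σ, Measurable (u σ)) (m : ℕ) (t : ℝ) :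
    Integrable (fun ω => faceNum u m ω t) P :=
  integrable_finsetSum _ fun σ _ => integrable_indicator_forall_le hmeas σ t

theorem integral_faceNum {P : Measure Ω} [IsProbabilityMeasure P] {p : ℕ → ℝ → ℝ}
    {u : {σ : Finset (Fin n) // σ.Nonempty} → Ω → ℝ} (hmeas : ∀ σ, Measurable (u σ))
    (hindep : iIndepFun u P) (hdist : ∀ σ t, cdf (P.map (u σ)) t = p (σ.1.card - 1) t)
    (m : ℕ) (t : ℝ) : ∫ ω, faceNum u m ω t ∂P = n.choose m * q p m t := by
  simp only [faceNum]
  rw [integral_finsetSum _ fun σ _ => integrable_indicator_forall_le hmeas σ t,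
    Finset.sum_congr rfl (g := fun _ => q p m t), Finset.sum_const, Finset.card_powersetCard,
    Finset.card_univ, Fintype.card_fin, nsmul_eq_mul]
  intro σ hσ
  rw [← (Finset.mem_powersetCard.1 hσ).2, ← measure_forall_le_eq_q hmeas hindep hdist σ t]
  exact integral_indicator_one (measurable_prodMk_right (measurableSet_forall_le hmeas σ))

theorem lintegral_q_le_lintegral_lifetimeSumUntil {P : Measure Ω} [IsProbabilityMeasure P]
    {p : ℕ → ℝ → ℝ} {u : {σ : Finset (Fin n) // σ.Nonempty} → Ω → ℝ}
    (hmeas : ∀ σ, Measurable (u σ)) (hindep : iIndepFun u P)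
    (hdist : ∀ σ t, cdf (P.map (u σ)) t = p (σ.1.card - 1) t) (k : ℕ)
    {s s' : ℝ} {T : ℝ≥0} (hs : 0 ≤ s) (hs' : s' ≤ T) :
    ∫⁻ t in Set.Ioc s s', ENNReal.ofReal (n.choose (k + 1) * q p (k + 1) t -
        n.choose (k + 2) * q p (k + 2) t - n.choose k * q p k t) ≤
      ∫⁻ ω, lifetimeSumUntil (complexProcess fun σ => u σ ω) k T ∂P := by
  have hint : ∀ t, Integrable
      (fun ω => faceNum u (k + 1) ω t - faceNum u (k + 2) ω t - faceNum u k ω t) P := fun t =>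
    ((integrable_faceNum hmeas _ t).sub (integrable_faceNum hmeas _ t)).sub
      (integrable_faceNum hmeas _ t)
  calc _ ≤ ∫⁻ t in Set.Ioc s s', ∫⁻ ω, ENNReal.ofReal
        (faceNum u (k + 1) ω t - faceNum u (k + 2) ω t - faceNum u k ω t) ∂P := by
        refine lintegral_mono fun t => ?_
        rw [← integral_faceNum hmeas hindep hdist (k + 1), ← integral_faceNum hmeas hindep hdist k,
          ← integral_faceNum hmeas hindep hdist (k + 2),
          ← integral_sub (integrable_faceNum hmeas _ t) (integrable_faceNum hmeas _ t),
          ← integral_sub (f := fun ω => faceNum u (k + 1) ω t - faceNum u (k + 2) ω t)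
            ((integrable_faceNum hmeas _ t).sub (integrable_faceNum hmeas _ t))
            (integrable_faceNum hmeas _ t)]
        exact ofReal_integral_le_lintegral (hint t)
    _ = ∫⁻ ω, (∫⁻ t in Set.Ioc s s', ENNReal.ofReal
        (faceNum u (k + 1) ω t - faceNum u (k + 2) ω t - faceNum u k ω t)) ∂P := by
        refine (lintegral_lintegral_swap ?_).symm
        exact (((measurable_faceNum hmeas (k + 1)).sub (measurable_faceNum hmeas (k + 2))).sub
          (measurable_faceNum hmeas k)).ennreal_ofReal.aemeasurable
    _ ≤ _ := by
        -- Monotonicity of the lower integral requires no measurability of the lifetime sum in `ω`.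
        refine lintegral_mono fun ω => ?_
        refine le_trans ?_ (lintegral_finrank_homology_le_lifetimeSumUntil _
          (exists_gt_complexProcess_le _) k hs hs')
        exact setLIntegral_mono' measurableSet_Ioc fun t ht =>
          ofReal_faceNum_le_finrank u k ω (hs.trans ht.1.le)

end Probability

/-! ### Binomial estimates -/

section Asymptotics

theorem pow_le_choose_mul (k n : ℕ) (hn : 2 * k ≤ n) :
    (n : ℝ) ^ (k + 1) / (2 ^ (k + 1) * (k + 1).factorial) ≤ n.choose (k + 1) := by
  have h := Nat.pow_le_choose (α := ℝ) (k + 1) n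
  have h2 : (n : ℝ) / 2 ≤ ((n + 1 - (k + 1) : ℕ) : ℝ) := by
    rw [Nat.add_sub_add_right, Nat.cast_sub (by omega)]
    have : (2 : ℝ) * k ≤ n := by exact_mod_cast hn
    linarith
  refine le_trans ?_ h
  rw [← div_div, ← div_pow]
  exact div_le_div_of_nonneg_right (pow_le_pow_left₀ (by positivity) h2 _) (by positivity)

theorem choose_succ_mul_div_le (n k : ℕ) (hn : 0 < n) :
    (n.choose (k + 2) : ℝ) * (((k : ℝ) + 2) / 2 / n) ≤ n.choose (k + 1) / 2 := by
  have h : n.choose (k + 2) * (k + 2) ≤ n.choose (k + 1) * n := by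
    rw [Nat.choose_succ_right_eq]
    exact Nat.mul_le_mul_left _ (Nat.sub_le _ _)
  have h' : (n.choose (k + 2) : ℝ) * (k + 2) ≤ n.choose (k + 1) * n := by exact_mod_cast h
  have hn' : (0 : ℝ) < n := by exact_mod_cast hn
  rw [div_div, ← mul_div_assoc, div_le_div_iff₀ (by positivity) (by positivity)]
  linarith

theorem choose_mul_div_le {k n : ℕ} {a γ : ℝ} (hn : k ≤ n)
    (h : ((k : ℝ) + 1) / a * n ≤ γ * (n - k)) :
    (n.choose k : ℝ) * (n / a) ≤ γ * n.choose (k + 1) := by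
  have h1 : (n.choose (k + 1) : ℝ) * (k + 1) = n.choose k * (n - k) := by
    have := Nat.choose_succ_right_eq n k
    rw [← Nat.cast_sub hn]
    exact_mod_cast this
  have hk : (0 : ℝ) < k + 1 := by positivity
  refine le_of_mul_le_mul_right ?_ hk
  calc (n.choose k : ℝ) * (n / a) * (k + 1) = n.choose k * ((k + 1) / a * n) := by ring
    _ ≤ n.choose k * (γ * (n - k)) := mul_le_mul_of_nonneg_left h (by positivity)
    _ = γ * n.choose (k + 1) * (k + 1) := by rw [mul_assoc, h1]; ring

theorem eventually_mul_le_mul_sub {α γ : ℝ} (h : α < γ) (k : ℕ) :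
    ∀ᶠ n : ℕ in atTop, α * n ≤ γ * (n - k) := by
  have : Tendsto (fun n : ℕ => (γ - α) * (n : ℝ)) atTop atTop :=
    tendsto_natCast_atTop_atTop.const_mul_atTop (sub_pos.2 h)
  filter_upwards [this.eventually_ge_atTop (γ * k)] with n hn
  linarith

/-- The lower bound for the expected Morse inequality in the range where `n r_k` is at most
`(k + 2) / 2` and `n r_{k-1}` is at least `a > 2 (k + 1)`. -/
theorem exists_pos_eventually_le_choose_sub (k : ℕ) {a : ℝ} (ha : 2 * ((k : ℝ) + 1) < a) :
    ∃ δ > 0, ∀ᶠ n : ℕ in atTop, ∀ x y z : ℝ, 0 ≤ x → y ≤ ((k : ℝ) + 2) / 2 / n * x →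
      z ≤ n / a * x →
      δ * n ^ (k + 1) * x ≤
        n.choose (k + 1) * x - n.choose (k + 2) * y - n.choose k * z := by
  have ha0 : 0 < a := lt_trans (by positivity) ha
  -- The gap between (k+1)/a and γ absorbs the ratio n/(n - k); the gap between γ and 1/2 yields δ.
  obtain ⟨γ, h1, h2⟩ := exists_between
    (show ((k : ℝ) + 1) / a < 1 / 2 by rw [div_lt_div_iff₀ ha0 two_pos]; linarith)
  refine ⟨(1 / 2 - γ) / (2 ^ (k + 1) * (k + 1).factorial),
    div_pos (sub_pos.2 h2) (by positivity), ?_⟩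
  filter_upwards [eventually_mul_le_mul_sub h1 k, eventually_ge_atTop (2 * k),
    eventually_gt_atTop 0] with n hn hk hn0 x y z hx hy hz
  have e1 := pow_le_choose_mul k n hk
  have e2 := choose_succ_mul_div_le n k hn0
  have e3 := choose_mul_div_le (by omega) hn
  have e4 : (n.choose (k + 2) : ℝ) * y ≤ n.choose (k + 1) / 2 * x :=
    calc (n.choose (k + 2) : ℝ) * y ≤ n.choose (k + 2) * (((k : ℝ) + 2) / 2 / n * x) :=
          mul_le_mul_of_nonneg_left hy (by positivity)
      _ = n.choose (k + 2) * (((k : ℝ) + 2) / 2 / n) * x := by ring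
      _ ≤ _ := mul_le_mul_of_nonneg_right e2 hx
  have e5 : (n.choose k : ℝ) * z ≤ γ * n.choose (k + 1) * x :=
    calc (n.choose k : ℝ) * z ≤ n.choose k * (n / a * x) :=
          mul_le_mul_of_nonneg_left hz (by positivity)
      _ = n.choose k * (n / a) * x := by ring
      _ ≤ _ := mul_le_mul_of_nonneg_right e3 hx
  calc (1 / 2 - γ) / (2 ^ (k + 1) * (k + 1).factorial) * n ^ (k + 1) * x
      = (1 / 2 - γ) * ((n : ℝ) ^ (k + 1) / (2 ^ (k + 1) * (k + 1).factorial)) * x := by ring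
    _ ≤ (1 / 2 - γ) * n.choose (k + 1) * x :=
        mul_le_mul_of_nonneg_right (mul_le_mul_of_nonneg_left e1 (sub_pos.2 h2).le) hx
    _ ≤ _ := by linarith

end Asymptotics

/-! ### Integration over the window -/

section Main

variable {p : ℕ → ℝ → ℝ}

theorem ofReal_Q_sub_le_lintegral (h0 : ∀ j t, 0 ≤ p j t) (hmono : ∀ j, Monotone (p j)) (k : ℕ)
    {C s s' : ℝ} (hC : 0 ≤ C) {f : ℝ → ℝ}
    (hf : ∀ t ∈ Set.Ioo s s', C * q p (k + 1) t ≤ f t) :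
    ENNReal.ofReal (C * (Q p k s' - Q p k s)) ≤ ∫⁻ t in Set.Ioc s s', ENNReal.ofReal (f t) := by
  rcases lt_or_ge s' s with h | h
  -- If the window is reversed, the left side is zero because Q is monotone.
  · rw [ENNReal.ofReal_of_nonpos]
    · exact zero_le
    · exact mul_nonpos_of_nonneg_of_nonpos hC (sub_nonpos.2 (Q_mono h0 hmono k h.le))
  · rw [Q_sub_Q h0 hmono, intervalIntegral.integral_of_le h, ← integral_const_mul,
      ofReal_integral_eq_lintegral_ofReal, ← restrict_Ioo_eq_restrict_Ioc]
    · exact setLIntegral_mono' measurableSet_Ioo fun t ht => ENNReal.ofReal_le_ofReal (hf t ht)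
    · exact (((q_mono h0 hmono _).intervalIntegrable (a := s) (b := s')).1).const_mul C
    · exact ae_of_all _ fun t => mul_nonneg hC (q_nonneg h0 _ t)

theorem q_le_of_mem_Ioo (h0 : ∀ j t, 0 ≤ p j t) (hmono : ∀ j, Monotone (p j))
    (hlim : ∀ j, Tendsto (p j) atTop (nhds 1)) (k : ℕ) {x y t : ℝ} (hx : 0 < x) (hx1 : x < 1)
    (ht : t ∈ Set.Ioo (rInv p k x) (rInv p (k + 1) y)) :
    q p (k + 2) t ≤ y * q p (k + 1) t ∧ q p k t ≤ x⁻¹ * q p (k + 1) t := by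
  have ht0 : 0 ≤ t := (rInv_nonneg k x).trans ht.1.le
  constructor
  · rw [← r_mul_q (k + 1)]
    exact mul_le_mul_of_nonneg_right (r_le_of_lt_rInv ht0 ht.2) (q_nonneg h0 _ t)
  · rw [← r_mul_q k, ← div_eq_inv_mul, le_div_iff₀ hx, mul_comm]
    exact mul_le_mul_of_nonneg_right (lt_r_of_rInv_lt h0 hmono hlim hx1 ht.1).le (q_nonneg h0 _ t)

end Main

end LifetimeSum

end

/-! ### The lower bound -/

open LifetimeSum in
theorem mainTheorem6 (k : ℕ) (p : ℕ → ℝ → ℝ)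
    {Ω : ℕ → Type*} [∀ n, MeasurableSpace (Ω n)]
    (P : ∀ n, Measure (Ω n)) [∀ n, IsProbabilityMeasure (P n)]
    (u : ∀ n, {σ : Finset (Fin n) // σ.Nonempty} → Ω n → ℝ)
    (hmeas : ∀ n σ, Measurable (u n σ))
    (hnonneg : ∀ n σ, ∀ᵐ ω ∂(P n), 0 ≤ u n σ ω)
    (hindep : ∀ n, iIndepFun (u n) (P n))
    (hdist : ∀ n σ t, cdf ((P n).map (u n σ)) t = p (σ.1.card - 1) t)
    (u₀ B D : ℝ) (hu₀ : 0 < u₀) (hu₀' : u₀ < 1) (hB : 1 < B)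
    (hD : 0 ≤ D) (hD' : D < ((k : ℝ) + 2) / (4 * ((k : ℝ) + 1)))
    (hPhi : ∀ x : ℝ, 0 ≤ x → x ≤ u₀ →
      B * LifetimeSum.Psi p k x ≤ LifetimeSum.Phi p k (D * x)) :
    (∃ c : ℝ, 0 < c ∧ ∀ T : ℝ≥0, LifetimeSum.rInv p (k + 1) 0 < (T : ℝ) →
      ∀ᶠ n : ℕ in atTop,
        ENNReal.ofReal (c * (n : ℝ) ^ (k + 1) * LifetimeSum.Phi p k (1 / (n : ℝ))) ≤
          ∫⁻ ω, LifetimeSum.lifetimeSumUntil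
            (LifetimeSum.complexProcess fun σ => u n σ ω) k T ∂(P n)) ∧
    (∃ c : ℝ, 0 < c ∧ ∀ᶠ n : ℕ in atTop,
        ENNReal.ofReal (c * (n : ℝ) ^ (k + 1) * LifetimeSum.Phi p k (1 / (n : ℝ))) ≤
          ∫⁻ ω, LifetimeSum.lifetimeSum
            (LifetimeSum.complexProcess fun σ => u n σ ω) k ∂(P n)) := by
  have hp : ∀ j, ∃ μ : Measure ℝ, p j = cdf μ := fun j => by
    -- A simplex with `j + 1` vertices exists once n = j + 1, so every `p j` is the cdf of some u.
    refine ⟨(P (j + 1)).map (u (j + 1) ⟨Finset.univ, Finset.univ_nonempty⟩), funext fun t => ?_⟩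
    rw [hdist, Finset.card_univ, Fintype.card_fin, Nat.add_sub_cancel]
  have h0 : ∀ j t, 0 ≤ p j t := fun j t => by
    obtain ⟨μ, h⟩ := hp j
    exact h ▸ cdf_nonneg μ t
  have hmono : ∀ j, Monotone (p j) := fun j => by
    obtain ⟨μ, h⟩ := hp j
    exact h ▸ monotone_cdf μ
  have hlim : ∀ j, Tendsto (p j) atTop (nhds 1) := fun j => by
    obtain ⟨μ, h⟩ := hp j
    exact h ▸ tendsto_cdf_atTop μ
  -- D may be 0, so a positive D' is used to define `a`; the upper bound on D' amounts to a >
  -- 2(k+1).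
  obtain ⟨D', hDD', hD'lt⟩ := exists_between hD'
  have hD'0 : 0 < D' := hD.trans_lt hDD'
  have hk : (0 : ℝ) ≤ k := k.cast_nonneg
  rw [lt_div_iff₀ (by positivity)] at hD'lt
  have hD'1 : D' < 1 := by nlinarith
  set a : ℝ := ((k : ℝ) + 2) / 2 / D' with ha_def
  have ha : 2 * ((k : ℝ) + 1) < a := by
    rw [ha_def, lt_div_iff₀ hD'0]
    linarith
  have ha0 : 0 < a := lt_trans (by positivity) ha
  obtain ⟨δ, hδ, hev⟩ := exists_pos_eventually_le_choose_sub k ha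
  have hB' : 0 < 1 - B⁻¹ := sub_pos.2 (inv_lt_one_of_one_lt₀ hB)
  have main : ∀ T : ℝ≥0, rInv p (k + 1) 0 < (T : ℝ) → ∀ᶠ n : ℕ in atTop,
      ENNReal.ofReal (δ * (1 - B⁻¹) * (n : ℝ) ^ (k + 1) * Phi p k (1 / (n : ℝ))) ≤
        ∫⁻ ω, lifetimeSumUntil (complexProcess fun σ => u n σ ω) k T ∂(P n) := by
    intro T hT
    obtain ⟨ε, hε, hεT⟩ := exists_forall_lt_rInv_lt h0 hmono hlim hT
    filter_upwards [hev, eventually_gt_atTop 0,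
      (tendsto_const_div_atTop_nhds_zero_nat a).eventually_lt_const hu₀,
      (tendsto_const_div_atTop_nhds_zero_nat (((k : ℝ) + 2) / 2)).eventually_lt_const hε]
      with n hn hn0 hna hnb
    have hn0' : (0 : ℝ) < n := by exact_mod_cast hn0
    have hx0 : 0 < a / n := div_pos ha0 hn0'
    have hDa : D' * (a / n) = ((k : ℝ) + 2) / 2 / n := by
      rw [ha_def]
      field_simp
    have hy1 : ((k : ℝ) + 2) / 2 / n < 1 := by
      rw [← hDa]
      exact mul_lt_one_of_nonneg_of_lt_one_left hD'0.le hD'1 (hna.trans hu₀').le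
    have hPsi : B * Psi p k (a / n) ≤ Phi p k (((k : ℝ) + 2) / 2 / n) := by
      refine (hPhi _ hx0.le hna.le).trans (Phi_mono h0 hmono hlim k ?_ hy1)
      rw [← hDa]
      exact mul_le_mul_of_nonneg_right hDD'.le hx0.le
    -- Here 1 ≤ (k+2)/2.
    have hPhi1 : Phi p k (1 / n) ≤ Phi p k (((k : ℝ) + 2) / 2 / n) :=
      Phi_mono h0 hmono hlim k (div_le_div_of_nonneg_right (by linarith) hn0'.le) hy1
    have hdiff : (1 - B⁻¹) * Phi p k (1 / n) ≤
        Phi p k (((k : ℝ) + 2) / 2 / n) - Psi p k (a / n) := by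
      have h1 : Psi p k (a / n) ≤ B⁻¹ * Phi p k (((k : ℝ) + 2) / 2 / n) := by
        rw [← div_eq_inv_mul, le_div_iff₀ (one_pos.trans hB)]
        linarith
      have h2 := mul_le_mul_of_nonneg_left hPhi1 hB'.le
      linarith
    refine le_trans ?_ (lintegral_q_le_lintegral_lifetimeSumUntil (hmeas n) (hindep n) (hdist n) k
      (rInv_nonneg (p := p) k (a / n)) (hεT _ hnb))
    refine le_trans (ENNReal.ofReal_le_ofReal ?_) (ofReal_Q_sub_le_lintegral h0 hmono k
      (C := δ * n ^ (k + 1)) (by positivity) fun t ht => ?_)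
    · calc δ * (1 - B⁻¹) * (n : ℝ) ^ (k + 1) * Phi p k (1 / (n : ℝ))
          = δ * n ^ (k + 1) * ((1 - B⁻¹) * Phi p k (1 / n)) := by ring
        _ ≤ _ := mul_le_mul_of_nonneg_left hdiff (by positivity)
    · obtain ⟨h1, h2⟩ := q_le_of_mem_Ioo h0 hmono hlim k hx0 (hna.trans hu₀') ht
      rw [inv_div] at h2
      exact hn _ _ _ (q_nonneg h0 _ t) h1 h2
  refine ⟨⟨δ * (1 - B⁻¹), mul_pos hδ hB', main⟩, δ * (1 - B⁻¹), mul_pos hδ hB', ?_⟩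
  -- Any single admissible T suffices for the untruncated sum.
  have hT : rInv p (k + 1) 0 < ((rInv p (k + 1) 0 + 1).toNNReal : ℝ) := by
    rw [Real.coe_toNNReal _ (add_nonneg (rInv_nonneg _ _) zero_le_one)]
    exact lt_add_one _
  filter_upwards [main _ hT] with n hn
  exact hn.trans (lintegral_mono fun ω => lifetimeSumUntil_le_lifetimeSum _ _ _)
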